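/- An \emph{ordinal graph} is a small category $\Lambda$ (identified with its set of morphisms, with source and range maps $s,r$, the identity morphisms being called vertices) together with a functor $d:\Lambda\to\mathrm{Ord}$ (so $d(fg)=d(f)+d(g)$ whenever $s(f)=r(g)$) such that for every $e\in\Lambda$ and every ordinal $\alpha\le d(e)$ there are unique $f,g\in\Lambda$ with $e=fg$ and $d(f)=\alpha$. Write $\Lambda^{\alpha}=\{f\in\Lambda: d(f)=\alpha\}$ and $\Lambda_\alpha=\{f\in\Lambda: d(f)<\omega^\alpha\}$; $\Lambda_\alpha$ is again an ordinal graph and $\Lambda_0=\Lambda^0$ is the set of vertices. A vertex $v$ is \emph{$\alpha$-regular} if $v\Lambda^{\omega^\alpha}=\{f\in\Lambda^{\omega^\alpha}:r(f)=v\}$ is finite and for every $e\in\Lambda_\alpha$ with $r(e)=v$ there is $f\in\Lambda^{\omega^\alpha}$ with $r(f)=s(e)$. $\mathcal O(\Lambda)$ denotes the universal C*-algebra generated by partial isometries $T_e$, where $e$ is a vertex or $d(e)$ is a power of $\omega$, subject to the relations (1) $T_e^*T_e=T_{s(e)}$; (2) $T_eT_f=T_{ef}$ if $s(e)=r(f)$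 and $d(e)<d(f)$; (3) $T_e^*T_f=0$ if $e\Lambda\cap f\Lambda=\emptyset$; (4) $T_v=\sum_{e\in v\Lambda^{\omega^\alpha}}T_eT_e^*$ if $v$ is an $\alpha$-regular vertex. For arbitrary $e\in\Lambda$ which is not a vertex, $T_e\in\mathcal O(\Lambda)$ is defined as $T_{e_1}T_{e_2}\cdots T_{e_n}$, where $e=e_1e_2\cdots e_n$ is the factorization with $d(e_k)=\omega^{\gamma_k}$, $\gamma_1\ge\gamma_2\ge\dots\ge\gamma_n$, given by the Cantor normal form of $d(e)$. \textbf{Proposition.} Let $\Lambda$ be an ordinal graph. For all ordinals $\alpha\le\beta$ there is a $*$-homomorphism $\rho_\alpha^\beta:\mathcal O(\Lambda_\alpha)\to\mathcal O(\Lambda_\beta)$ such that $\rho_\alpha^\beta(T_e)=T_e$ for all $e\in\Lambda_\alpha$. These maps satisfy $\rho_\alpha^\alpha=\mathrm{id}$ and $\rho_\beta^\gamma\circ\rho_\alpha^\beta=\rho_\alpha^\gamma$ for $\alpha\le\beta\le\gamma$, and for every limit ordinal $\beta>0$, \[ \mathcal O(\Lambda_\beta)\cong\varinjlim\left(\mathcal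 O(\Lambda_\alpha),\rho_\alpha^\gamma\right)_{\alpha<\gamma<\beta} \] as C*-algebras, with canonical maps $\rho_\alpha^\beta$; that is, $\rho_\gamma^\beta\circ\rho_\alpha^\gamma=\rho_\alpha^\beta$ for $\alpha\le\gamma<\beta$, and for every C*-algebra $B$ and all $*$-homomorphisms $\varepsilon_\alpha:\mathcal O(\Lambda_\alpha)\to B$ $(\alpha<\beta)$ with $\varepsilon_\gamma\circ\rho_\alpha^\gamma=\varepsilon_\alpha$ for $\alpha\le\gamma<\beta$ there is a unique $*$-homomorphism $\varepsilon:\mathcal O(\Lambda_\beta)\to B$ with $\varepsilon\circ\rho_\alpha^\beta=\varepsilon_\alpha$ for all $\alpha<\beta$. -/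

import Mathlib

open CategoryTheory

/-! ### Free `*`-algebras and universal C*-algebras of presentations -/

/-- Words in the letters `x` (`Sum.inl x`) and the formal adjoints `x^*` (`Sum.inr x`). -/
abbrev StarWord (X : Type*) := FreeSemigroup (X ⊕ X)

namespace StarWord

variable {X : Type*}

/-- The adjoint of a word: reverse it and replace each letter by its formal adjoint. -/
def adj : StarWord X →ₙ* (StarWord X)ᵐᵒᵖ :=
  FreeSemigroup.lift fun x => MulOpposite.op (FreeSemigroup.of x.swap)

instance : StarMul (StarWord X) where
  star w := (adj w).unop
  star_involutive w := by
    induction w using FreeSemigroup.recOnMul with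
    | ih1 x => simp [adj]
    | ih2 x y hx hy =>
      simp only [map_mul, MulOpposite.unop_mul] at hx hy ⊢
      rw [hx, hy]
  star_mul w w' := by
    rw [map_mul, MulOpposite.unop_mul]

end StarWord

/-- The free (non-unital) complex `*`-algebra on a set `X` of generators: the finitely supported
complex linear combinations of words, with concatenation as product. -/
def FreeStarAlg (X : Type*) := MonoidAlgebra ℂ (StarWord X)

namespace FreeStarAlg

variable {X : Type*}

noncomputable instance : NonUnitalRing (FreeStarAlg X) :=
  inferInstanceAs (NonUnitalRing (MonoidAlgebra ℂ (StarWord X)))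

noncomputable instance : Module ℂ (FreeStarAlg X) :=
  inferInstanceAs (Module ℂ (MonoidAlgebra ℂ (StarWord X)))

noncomputable instance : IsScalarTower ℂ (FreeStarAlg X) (FreeStarAlg X) :=
  inferInstanceAs (IsScalarTower ℂ (MonoidAlgebra ℂ (StarWord X)) (MonoidAlgebra ℂ (StarWord X)))

noncomputable instance : SMulCommClass ℂ (FreeStarAlg X) (FreeStarAlg X) :=
  inferInstanceAs (SMulCommClass ℂ (MonoidAlgebra ℂ (StarWord X)) (MonoidAlgebra ℂ (StarWord X)))

/-- The element `c • w` of the free `*`-algebra. -/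
noncomputable def mono (w : StarWord X) (c : ℂ) : FreeStarAlg X := MonoidAlgebra.single w c

/-- The generators of the free `*`-algebra. -/
noncomputable def of (x : X) : FreeStarAlg X := mono (FreeSemigroup.of (Sum.inl x)) 1

theorem mono_add (w : StarWord X) (c c' : ℂ) : mono w (c + c') = mono w c + mono w c' :=
  MonoidAlgebra.single_add ..

theorem mono_zero (w : StarWord X) : mono w 0 = 0 := MonoidAlgebra.single_zero ..

theorem mono_mul (w w' : StarWord X) (c c' : ℂ) :
    mono w c * mono w' c' = mono (w * w') (c * c') := MonoidAlgebra.single_mul_single ..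

theorem smul_mono (w : StarWord X) (c c' : ℂ) : c • mono w c' = mono w (c * c') :=
  MonoidAlgebra.smul_single ..

@[elab_as_elim]
theorem induction {P : FreeStarAlg X → Prop} (a : FreeStarAlg X) (h0 : P 0)
    (hm : ∀ w c, P (mono w c)) (ha : ∀ a b, P a → P b → P (a + b)) : P a :=
  MonoidAlgebra.induction_linear (motive := P) a h0 ha hm

/-- The conjugate-linear extension of the adjoint of words. -/
noncomputable def adj : FreeStarAlg X →+ FreeStarAlg X :=
  (Finsupp.liftAddHom fun w : StarWord X =>
    ({ toFun := fun c : ℂ => mono (star w) (star c)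
       map_zero' := by rw [star_zero, mono_zero]
       map_add' := fun c c' => by rw [star_add, mono_add] } : ℂ →+ FreeStarAlg X)).comp
    (MonoidAlgebra.coeffAddEquiv (R := ℂ) (M := StarWord X)).toAddMonoidHom

theorem adj_mono (w : StarWord X) (c : ℂ) : adj (mono w c) = mono (star w) (star c) :=
  (Finsupp.liftAddHom_apply_single _ w c)

noncomputable instance : StarRing (FreeStarAlg X) where
  star := adj
  star_involutive a := by
    induction a using induction with
    | h0 => simp
    | hm w c => simp [adj_mono]
    | ha a b ha hb => rw [map_add, map_add, ha, hb]
  star_add a b := map_add adj a b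
  star_mul a b := by
    induction a using induction with
    | h0 => simp
    | ha a a' ha ha' => rw [add_mul, map_add, map_add, mul_add, ha, ha']
    | hm w c =>
      induction b using induction with
      | h0 => simp
      | ha b b' hb hb' => rw [mul_add, map_add, map_add, add_mul, hb, hb']
      | hm w' c' => simp only [mono_mul, adj_mono, star_mul]

theorem star_mono (w : StarWord X) (c : ℂ) : star (mono w c) = mono (star w) (star c) :=
  adj_mono w c

noncomputable instance : StarModule ℂ (FreeStarAlg X) where
  star_smul c a := by
    induction a using induction with
    | h0 => simp
    | hm w c' => simp only [smul_mono, star_mono, star_mul']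
    | ha a b ha hb => rw [smul_add, star_add, star_add, smul_add, ha, hb]

theorem star_of (x : X) :
    star (of x : FreeStarAlg X) = mono (FreeSemigroup.of (Sum.inr x)) 1 := by
  rw [of, star_mono, star_one]
  rfl

end FreeStarAlg

/-- A C*-seminorm on a complex `*`-algebra. -/
structure CStarSeminorm (A : Type*) [NonUnitalRing A] [StarRing A] [Module ℂ A]
    extends Seminorm ℂ A where
  mul_le' : ∀ a b, toFun (a * b) ≤ toFun a * toFun b
  star_mul_self' : ∀ a, toFun (star a * a) = toFun a ^ 2

namespace CStarSeminorm

variable {A : Type*} [NonUnitalRing A] [StarRing A] [Module ℂ A]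

noncomputable instance : CoeFun (CStarSeminorm A) fun _ => A → ℝ := ⟨fun p => p.toSeminorm⟩

theorem mul_le (p : CStarSeminorm A) (a b : A) : p (a * b) ≤ p a * p b := p.mul_le' a b

theorem star_mul_self (p : CStarSeminorm A) (a : A) : p (star a * a) = p a ^ 2 :=
  p.star_mul_self' a

theorem le_star (p : CStarSeminorm A) (a : A) : p a ≤ p (star a) := by
  have h1 := p.star_mul_self a
  have h2 := p.mul_le (star a) a
  have h3 : 0 ≤ p a := apply_nonneg p.toSeminorm a
  have h4 : 0 ≤ p (star a) := apply_nonneg p.toSeminorm _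
  by_contra! h
  nlinarith

theorem star (p : CStarSeminorm A) (a : A) : p (star a) = p a :=
  le_antisymm (by simpa using p.le_star (Star.star a)) (p.le_star a)

/-- The zero seminorm. -/
noncomputable def zero : CStarSeminorm A where
  toSeminorm := 0
  mul_le' _ _ := (zero_mul (0 : ℝ)).ge
  star_mul_self' _ := (zero_pow two_ne_zero : (0 : ℝ) ^ 2 = 0).symm

end CStarSeminorm

/-- A presentation of a C*-algebra by generators `X` and relations `a = b`, for `rel a b`, between
elements of the free `*`-algebra. A C*-seminorm on the free `*`-algebra is admissible if it
satisfies the relations; the admissible C*-seminorms are required to be bounded on each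
generator. -/
structure CStarPresentation where
  X : Type*
  rel : FreeStarAlg X → FreeStarAlg X → Prop
  bounded : ∀ x : X, ∃ C : ℝ, ∀ p : CStarSeminorm (FreeStarAlg X),
    (∀ a b, rel a b → p (a - b) = 0) → p (FreeStarAlg.of x) ≤ C

namespace CStarPresentation

variable (P : CStarPresentation)

/-- The C*-seminorms on the free `*`-algebra in which the relations hold. -/
def Admissible : Type _ :=
  {p : CStarSeminorm (FreeStarAlg P.X) // ∀ a b, P.rel a b → p (a - b) = 0}

instance : Nonempty P.Admissible := ⟨⟨CStarSeminorm.zero, fun _ _ _ => rfl⟩⟩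

theorem bddAbove_word (w : StarWord P.X) :
    ∃ C : ℝ, ∀ p : P.Admissible, p.1 (FreeStarAlg.mono w 1) ≤ C := by
  have hof (x : P.X ⊕ P.X) :
      ∃ C : ℝ, ∀ p : P.Admissible, p.1 (FreeStarAlg.mono (FreeSemigroup.of x) 1) ≤ C := by
    rcases x with x | x
    · obtain ⟨C, hC⟩ := P.bounded x
      exact ⟨C, fun p => hC p.1 p.2⟩
    · obtain ⟨C, hC⟩ := P.bounded x
      refine ⟨C, fun p => ?_⟩
      rw [← FreeStarAlg.star_of, CStarSeminorm.star]
      exact hC p.1 p.2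
  induction w using FreeSemigroup.recOnMul with
  | ih1 x => exact hof x
  | ih2 x y hx hy =>
    obtain ⟨C, hC⟩ := hx
    obtain ⟨D, hD⟩ := hy
    refine ⟨C * D, fun p => ?_⟩
    have h : (FreeStarAlg.mono (FreeSemigroup.of x * y) 1 : FreeStarAlg P.X) =
        FreeStarAlg.mono (FreeSemigroup.of x) 1 * FreeStarAlg.mono y 1 := by
      rw [FreeStarAlg.mono_mul, one_mul]
    rw [h]
    have h1 : 0 ≤ p.1 (FreeStarAlg.mono (FreeSemigroup.of x) 1) :=
      apply_nonneg p.1.toSeminorm _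
    have h2 : 0 ≤ p.1 (FreeStarAlg.mono y 1) := apply_nonneg p.1.toSeminorm _
    exact (p.1.mul_le _ _).trans
      (mul_le_mul (hC p) (hD p) h2 (h1.trans (hC p)))

theorem bddAbove (a : FreeStarAlg P.X) :
    BddAbove (Set.range fun p : P.Admissible => p.1 a) := by
  suffices h : ∃ C : ℝ, ∀ p : P.Admissible, p.1 a ≤ C by
    obtain ⟨C, hC⟩ := h
    exact ⟨C, by rintro _ ⟨p, rfl⟩; exact hC p⟩
  induction a using FreeStarAlg.induction with
  | h0 => exact ⟨0, fun p => (map_zero p.1.toSeminorm).le⟩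
  | hm w c =>
    obtain ⟨C, hC⟩ := P.bddAbove_word w
    refine ⟨‖c‖ * C, fun p => ?_⟩
    have h : (FreeStarAlg.mono w c : FreeStarAlg P.X) = c • FreeStarAlg.mono w 1 := by
      rw [FreeStarAlg.smul_mono, mul_one]
    rw [h, map_smul_eq_mul]
    exact mul_le_mul_of_nonneg_left (hC p) (norm_nonneg c)
  | ha a b ha hb =>
    obtain ⟨C, hC⟩ := ha
    obtain ⟨D, hD⟩ := hb
    exact ⟨C + D, fun p => (map_add_le_add p.1.toSeminorm a b).trans (add_le_add (hC p) (hD p))⟩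

/-- The greatest admissible C*-seminorm: the pointwise supremum of all of them. -/
noncomputable def supFun (a : FreeStarAlg P.X) : ℝ := ⨆ p : P.Admissible, p.1 a

theorem le_supFun (p : P.Admissible) (a : FreeStarAlg P.X) : p.1 a ≤ P.supFun a :=
  le_ciSup (P.bddAbove a) p

theorem supFun_nonneg (a : FreeStarAlg P.X) : 0 ≤ P.supFun a :=
  Real.iSup_nonneg fun p => apply_nonneg p.1.toSeminorm a

/-- The greatest admissible C*-seminorm. -/
noncomputable def maxSeminorm : CStarSeminorm (FreeStarAlg P.X) where
  toSeminorm := Seminorm.of P.supFun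
    (fun a b => ciSup_le fun p => (map_add_le_add p.1.toSeminorm a b).trans
      (add_le_add (P.le_supFun p a) (P.le_supFun p b)))
    (fun c a => by
      simp only [supFun, map_smul_eq_mul]
      exact (Real.mul_iSup_of_nonneg (norm_nonneg c) _).symm)
  mul_le' a b := ciSup_le fun p => (p.1.mul_le a b).trans
    (mul_le_mul (P.le_supFun p a) (P.le_supFun p b) (apply_nonneg p.1.toSeminorm b)
      (P.supFun_nonneg a))
  star_mul_self' a := by
    change P.supFun (star a * a) = P.supFun a ^ 2
    apply le_antisymm
    · refine ciSup_le fun p => ?_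
      rw [p.1.star_mul_self]
      exact pow_le_pow_left₀ (apply_nonneg p.1.toSeminorm a) (P.le_supFun p a) 2
    · rw [← Real.le_sqrt (P.supFun_nonneg a) (P.supFun_nonneg _)]
      refine ciSup_le fun p => Real.le_sqrt_of_sq_le ?_
      rw [← p.1.star_mul_self]
      exact P.le_supFun p _

/-- The free `*`-algebra on the generators, equipped with the greatest admissible
C*-seminorm. -/
def Pre : Type _ := FreeStarAlg P.X

noncomputable instance : NonUnitalRing P.Pre := inferInstanceAs (NonUnitalRing (FreeStarAlg P.X))

noncomputable instance : StarRing P.Pre := inferInstanceAs (StarRing (FreeStarAlg P.X))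

noncomputable instance : Module ℂ P.Pre := inferInstanceAs (Module ℂ (FreeStarAlg P.X))

instance : IsScalarTower ℂ P.Pre P.Pre :=
  inferInstanceAs (IsScalarTower ℂ (FreeStarAlg P.X) (FreeStarAlg P.X))

instance : SMulCommClass ℂ P.Pre P.Pre :=
  inferInstanceAs (SMulCommClass ℂ (FreeStarAlg P.X) (FreeStarAlg P.X))

instance : StarModule ℂ P.Pre := inferInstanceAs (StarModule ℂ (FreeStarAlg P.X))

noncomputable instance : SeminormedAddCommGroup P.Pre :=
  fast_instance% P.maxSeminorm.toSeminorm.toAddGroupSeminorm.toSeminormedAddCommGroup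

noncomputable instance : NonUnitalSeminormedRing P.Pre where
  __ := (inferInstance : SeminormedAddCommGroup P.Pre)
  __ := (inferInstance : NonUnitalRing P.Pre)
  norm_mul_le := P.maxSeminorm.mul_le

noncomputable instance : NormedSpace ℂ P.Pre where
  norm_smul_le c a := (map_smul_eq_mul P.maxSeminorm.toSeminorm c a).le

instance : NormedStarGroup P.Pre where
  norm_star_le a := (P.maxSeminorm.star a).le

theorem Pre.norm_star_mul_self (a : P.Pre) : ‖star a * a‖ = ‖a‖ ^ 2 := P.maxSeminorm.star_mul_self a

/-- The universal C*-algebra of the presentation: the (Hausdorff) completion of the free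
`*`-algebra in the greatest admissible C*-seminorm. -/
def Alg : Type _ := UniformSpace.Completion P.Pre

namespace Alg

open UniformSpace UniformSpace.Completion

variable {P}

noncomputable instance : NormedAddCommGroup P.Alg :=
  inferInstanceAs (NormedAddCommGroup (Completion P.Pre))

instance : CompleteSpace P.Alg := inferInstanceAs (CompleteSpace (Completion P.Pre))

noncomputable instance : NormedSpace ℂ P.Alg :=
  inferInstanceAs (NormedSpace ℂ (Completion P.Pre))

/-- The canonical map of the free `*`-algebra into its completion. -/
noncomputable def coe (a : P.Pre) : P.Alg := (a : Completion P.Pre)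

theorem continuous_coe : Continuous (coe : P.Pre → P.Alg) := Completion.continuous_coe P.Pre

theorem isDenseInducing_coe : IsDenseInducing (coe : P.Pre → P.Alg) :=
  Completion.isDenseInducing_coe

theorem coe_add (a b : P.Pre) : coe (a + b) = coe a + coe b := Completion.coe_add a b

theorem coe_zero : coe (0 : P.Pre) = 0 := Completion.coe_zero

theorem coe_smul (c : ℂ) (a : P.Pre) : coe (c • a) = c • coe a := Completion.coe_smul c a

theorem norm_coe (a : P.Pre) : ‖coe a‖ = ‖a‖ := Completion.norm_coe a

theorem denseRange_coe : DenseRange (coe : P.Pre → P.Alg) := isDenseInducing_coe.dense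

/-- Two continuous functions on the completion agree if they do so on the free `*`-algebra. -/
theorem eq_of_coe {f g : P.Alg → P.Alg} (hf : Continuous f) (hg : Continuous g)
    (h : ∀ a, f (coe a) = g (coe a)) (x : P.Alg) : f x = g x :=
  congr_fun (denseRange_coe.equalizer hf hg (funext h)) x

theorem eq_of_coe₂ {f g : P.Alg × P.Alg → P.Alg} (hf : Continuous f) (hg : Continuous g)
    (h : ∀ a b, f (coe a, coe b) = g (coe a, coe b)) (x y : P.Alg) : f (x, y) = g (x, y) :=
  congr_fun ((denseRange_coe.prodMap denseRange_coe).equalizer hf hg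
    (funext fun p => h p.1 p.2)) (x, y)

theorem eq_of_coe₃ {f g : P.Alg × P.Alg × P.Alg → P.Alg} (hf : Continuous f) (hg : Continuous g)
    (h : ∀ a b c, f (coe a, coe b, coe c) = g (coe a, coe b, coe c)) (x y z : P.Alg) :
    f (x, y, z) = g (x, y, z) :=
  congr_fun ((denseRange_coe.prodMap (denseRange_coe.prodMap denseRange_coe)).equalizer hf hg
    (funext fun p => h p.1 p.2.1 p.2.2)) (x, y, z)

/-- The product of the completion, extending that of the free `*`-algebra by continuity. -/
noncomputable instance : Mul P.Alg where
  mul := Function.curry <| (isDenseInducing_coe.prodMap isDenseInducing_coe).extend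
    fun p : P.Pre × P.Pre => coe (p.1 * p.2)

theorem coe_mul (a b : P.Pre) : coe (a * b) = coe a * coe b :=
  ((isDenseInducing_coe.prodMap isDenseInducing_coe).extend_eq
    (continuous_coe.comp continuous_mul) (a, b)).symm

/-- The canonical map as an additive homomorphism. -/
noncomputable def coeHom : P.Pre →+ P.Alg where
  toFun := coe
  map_zero' := coe_zero
  map_add' := coe_add

instance : ContinuousMul P.Alg where
  continuous_mul := by
    let m := (AddMonoidHom.mul : P.Pre →+ P.Pre →+ P.Pre).compr₂ coeHom
    have hm : Continuous fun p : P.Pre × P.Pre => m p.1 p.2 :=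
      continuous_coe.comp continuous_mul
    have di : IsDenseInducing (coeHom : P.Pre → P.Alg) := isDenseInducing_coe
    exact di.extend_Z_bilin di hm

/-- The involution of the completion, extending that of the free `*`-algebra by continuity. -/
noncomputable instance : Star P.Alg where
  star := Completion.map (star : P.Pre → P.Pre)

theorem coe_star (a : P.Pre) : coe (star a) = star (coe a) :=
  (Completion.map_coe (star_isometry (E := P.Pre)).uniformContinuous a).symm

instance : ContinuousStar P.Alg where
  continuous_star := Completion.continuous_map

noncomputable instance : NonUnitalRing P.Alg where
  __ := (inferInstance : AddCommGroup P.Alg)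
  __ := (inferInstance : Mul P.Alg)
  zero_mul := eq_of_coe (f := fun x => 0 * x) (g := fun _ => 0)
    (continuous_const.mul continuous_id) continuous_const fun a => by rw [← coe_zero, ← coe_mul, zero_mul]
  mul_zero := eq_of_coe (f := fun x => x * 0) (g := fun _ => 0)
    (continuous_id.mul continuous_const) continuous_const fun a => by rw [← coe_zero, ← coe_mul, mul_zero]
  mul_assoc := eq_of_coe₃ (f := fun p => p.1 * p.2.1 * p.2.2) (g := fun p => p.1 * (p.2.1 * p.2.2))
    (by fun_prop) (by fun_prop)
    fun a b c => by simp only [← coe_mul, mul_assoc]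
  left_distrib := eq_of_coe₃ (f := fun p => p.1 * (p.2.1 + p.2.2))
    (g := fun p => p.1 * p.2.1 + p.1 * p.2.2) (by fun_prop) (by fun_prop)
    fun a b c => by simp only [← coe_mul, ← coe_add, mul_add]
  right_distrib := eq_of_coe₃ (f := fun p => (p.1 + p.2.1) * p.2.2)
    (g := fun p => p.1 * p.2.2 + p.2.1 * p.2.2) (by fun_prop) (by fun_prop)
    fun a b c => by simp only [← coe_mul, ← coe_add, add_mul]

noncomputable instance : NonUnitalNormedRing P.Alg where
  __ := (inferInstance : NormedAddCommGroup P.Alg)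
  __ := (inferInstance : NonUnitalRing P.Alg)
  norm_mul_le x y := by
    refine (denseRange_coe.prodMap denseRange_coe).induction_on
      (p := fun p : P.Alg × P.Alg => ‖p.1 * p.2‖ ≤ ‖p.1‖ * ‖p.2‖) (x, y)
      (isClosed_le (by fun_prop) (by fun_prop)) fun p => ?_
    change ‖coe p.1 * coe p.2‖ ≤ ‖coe p.1‖ * ‖coe p.2‖
    rw [← coe_mul, norm_coe, norm_coe, norm_coe]
    exact norm_mul_le p.1 p.2

noncomputable instance : StarRing P.Alg where
  star_involutive := eq_of_coe (f := fun x => star (star x)) (g := fun x => x)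
    (continuous_star.comp continuous_star) continuous_id fun a => by rw [← coe_star, ← coe_star, star_star]
  star_mul := eq_of_coe₂ (f := fun p => star (p.1 * p.2)) (g := fun p => star p.2 * star p.1)
    (continuous_star.comp continuous_mul)
    ((continuous_star.comp continuous_snd).mul (continuous_star.comp continuous_fst))
    fun a b => by simp only [← coe_mul, ← coe_star, star_mul]
  star_add := eq_of_coe₂ (f := fun p => star (p.1 + p.2)) (g := fun p => star p.1 + star p.2)
    (continuous_star.comp continuous_add)
    ((continuous_star.comp continuous_fst).add (continuous_star.comp continuous_snd))
    fun a b => by simp only [← coe_add, ← coe_star, star_add]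

instance : IsScalarTower ℂ P.Alg P.Alg where
  smul_assoc c := eq_of_coe₂ (f := fun p => (c • p.1) * p.2) (g := fun p => c • (p.1 * p.2))
    ((continuous_fst.const_smul c).mul continuous_snd) (continuous_mul.const_smul c)
    fun a b => by simp only [← coe_mul, ← coe_smul, smul_mul_assoc]

instance : SMulCommClass ℂ P.Alg P.Alg where
  smul_comm c := eq_of_coe₂ (f := fun p => c • (p.1 * p.2)) (g := fun p => p.1 * (c • p.2))
    (continuous_mul.const_smul c) (continuous_fst.mul (continuous_snd.const_smul c))
    fun a b => by simp only [← coe_mul, ← coe_smul, mul_smul_comm]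

instance : StarModule ℂ P.Alg where
  star_smul c := eq_of_coe (f := fun x => star (c • x)) (g := fun x => star c • star x)
    (continuous_star.comp (continuous_const_smul c)) (continuous_star.const_smul (star c))
    fun a => by simp only [← coe_smul, ← coe_star, star_smul]

noncomputable instance : NonUnitalCStarAlgebra P.Alg where
  __ := (inferInstance : NonUnitalNormedRing P.Alg)
  __ := (inferInstance : StarRing P.Alg)
  __ := (inferInstance : NormedSpace ℂ P.Alg)
  __ := (inferInstance : CompleteSpace P.Alg)
  __ := (inferInstance : IsScalarTower ℂ P.Alg P.Alg)
  __ := (inferInstance : SMulCommClass ℂ P.Alg P.Alg)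
  __ := (inferInstance : StarModule ℂ P.Alg)
  norm_mul_self_le x := by
    refine denseRange_coe.induction_on (p := fun x : P.Alg => ‖x‖ * ‖x‖ ≤ ‖star x * x‖) x
      (isClosed_le (continuous_norm.mul continuous_norm)
        (continuous_norm.comp (continuous_star.mul continuous_id))) fun a => ?_
    rw [← coe_star, ← coe_mul, norm_coe, norm_coe, Pre.norm_star_mul_self, sq]

/-- The generators of the universal C*-algebra. -/
noncomputable def gen (x : P.X) : P.Alg := coe (FreeStarAlg.of x : FreeStarAlg P.X)

end Alg

end CStarPresentation

/-! ### Ordinal graphs -/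

set_option linter.checkUnivs false in
/-- An ordinal graph: a small category `Λ` (with set of objects `V`) together with a functor `d`
to the ordinals (a category with one object, composition being addition), with unique
factorization. The product `f g` of paths with `s(f) = r(g)` is `g ≫ f`. -/
structure OrdinalGraph.{v, u₁, u₂} where
  V : Type u₁
  [cat : Category.{u₂} V]
  d : ∀ {x y : V}, (x ⟶ y) → Ordinal.{v}
  d_id : ∀ x : V, d (𝟙 x) = 0
  d_comp : ∀ {x y z : V} (g : x ⟶ y) (f : y ⟶ z), d (g ≫ f) = d f + d g
  factorization : ∀ {x z : V} (e : x ⟶ z) (α : Ordinal.{v}), α ≤ d e →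
    ∃! p : Σ y : V, (y ⟶ z) × (x ⟶ y), d p.2.1 = α ∧ p.2.2 ≫ p.2.1 = e

attribute [instance] OrdinalGraph.cat

namespace OrdinalGraph

open Ordinal

universe v u₁ u₂

variable (G : OrdinalGraph.{v, u₁, u₂})

/-- The elements `e` of `Λ` (the paths), with source `s(e) = e.src` and range `r(e) = e.rng`. -/
structure Path where
  {src : G.V}
  {rng : G.V}
  hom : src ⟶ rng

variable {G} in
/-- The length `d(e)` of a path. -/
def Path.length (e : G.Path) : Ordinal.{v} := G.d e.hom

variable {G} in
/-- The set `eΛ` of all paths of the form `e g`. -/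
def Path.extensions (e : G.Path) : Set G.Path :=
  {p | ∃ (w : G.V) (g : w ⟶ e.src), p = ⟨g ≫ e.hom⟩}

/-- `v` is `α`-source-regular: every `e ∈ vΛ_α` has some `f ∈ s(e)Λ^{ω^α}`. -/
def IsSourceRegular (α : Ordinal.{v}) (v : G.V) : Prop :=
  ∀ e : G.Path, e.rng = v → e.length < ω ^ α → ∃ f : G.Path, f.rng = e.src ∧ f.length = ω ^ α

/-- `v` is `α`-row-finite: `vΛ^{ω^α}` is finite. -/
def IsRowFinite (α : Ordinal.{v}) (v : G.V) : Prop :=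
  {f : G.Path | f.rng = v ∧ f.length = ω ^ α}.Finite

/-- `v` is `α`-regular. -/
def IsRegular (α : Ordinal.{v}) (v : G.V) : Prop :=
  G.IsSourceRegular α v ∧ G.IsRowFinite α v

variable {G} in
/-- The length of `e` is zero (that is, `e` is a vertex) or a power of `ω`. -/
def Path.IsGen (e : G.Path) : Prop := e.length = 0 ∨ ∃ α : Ordinal.{v}, e.length = ω ^ α

/-- The index set of the generators: the paths of length a power of `ω`, and the vertices. -/
abbrev Gen := {e : G.Path // e.IsGen}

/-- The vertex `v` as a path of length zero. -/
def vertex (v : G.V) : G.Gen := ⟨⟨𝟙 v⟩, Or.inl (G.d_id v)⟩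

/-- The defining relations of a Cuntz-Krieger family `S`, indexed by the vertices and the paths
whose length is a power of `ω`, in a complex `*`-algebra: the `S e` are partial isometries with
1. `(S e)^* (S e) = S s(e)`;
2. `(S e) (S f) = S (ef)` if `s(e) = r(f)` and `d(e) < d(f)` (then `d(ef) = d(f)`, so that the
  hypothesis `hef` holds automatically);
3. `(S e)^* (S f) = 0` if `eΛ ∩ fΛ = ∅`;
4. `S v = ∑ (S e) (S e)^*`, the sum over the finite set `vΛ^{ω^α}`, if `v` is `α`-regular. -/
inductive CKRel {A : Type*} [NonUnitalRing A] [StarRing A] (S : G.Gen → A) : A → A → Prop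
  | partialIsometry (e : G.Gen) : CKRel S (S e * star (S e) * S e) (S e)
  | star_mul_self (e : G.Gen) : CKRel S (star (S e) * S e) (S (G.vertex e.1.src))
  | mul {x y z : G.V} (e : y ⟶ z) (f : x ⟶ y) (he : (⟨e⟩ : G.Path).IsGen)
      (hf : (⟨f⟩ : G.Path).IsGen) (hef : (⟨f ≫ e⟩ : G.Path).IsGen) (hlt : G.d e < G.d f) :
      CKRel S (S ⟨⟨e⟩, he⟩ * S ⟨⟨f⟩, hf⟩) (S ⟨⟨f ≫ e⟩, hef⟩)
  | orthogonal (e f : G.Gen) (h : e.1.extensions ∩ f.1.extensions = ∅) :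
      CKRel S (star (S e) * S f) 0
  | sum (v : G.V) (α : Ordinal.{v}) (h : G.IsRegular α v) (F : Finset G.Gen)
      (hF : ∀ e : G.Gen, e ∈ F ↔ e.1.rng = v ∧ e.1.length = ω ^ α) :
      CKRel S (S (G.vertex v)) (∑ e ∈ F, S e * star (S e))

theorem seminorm_gen_le_one (p : CStarSeminorm (FreeStarAlg G.Gen))
    (hp : ∀ a b, G.CKRel FreeStarAlg.of a b → p (a - b) = 0) (e : G.Gen) :
    p (FreeStarAlg.of e) ≤ 1 := by
  have key (e : G.Gen) :
      p (FreeStarAlg.of e) ^ 2 = p (FreeStarAlg.of (G.vertex e.1.src)) := by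
    have h := hp _ _ (CKRel.star_mul_self e)
    rw [← p.star_mul_self]
    have h1 := abs_sub_map_le_sub p.toSeminorm (star (FreeStarAlg.of e) * FreeStarAlg.of e)
      (FreeStarAlg.of (G.vertex e.1.src))
    have h2 := abs_nonneg (p (star (FreeStarAlg.of e) * FreeStarAlg.of e) -
      p (FreeStarAlg.of (G.vertex e.1.src)))
    have h3 := abs_eq_zero.1 (le_antisymm (h1.trans h.le) h2)
    linarith
  have h0 : 0 ≤ p (FreeStarAlg.of e) := apply_nonneg p.toSeminorm _
  have hv : p (FreeStarAlg.of (G.vertex e.1.src)) ^ 2 = p (FreeStarAlg.of (G.vertex e.1.src)) :=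
    key (G.vertex e.1.src)
  have h1 := key e
  have hv1 : p (FreeStarAlg.of (G.vertex e.1.src)) ≤ 1 := by
    by_contra! hlt
    nlinarith
  by_contra! hlt
  nlinarith

/-- The generators and relations of `𝒪(Λ)`. -/
noncomputable abbrev presentation : CStarPresentation where
  X := G.Gen
  rel := G.CKRel FreeStarAlg.of
  bounded e := ⟨1, fun p hp => G.seminorm_gen_le_one p hp e⟩

/-- The C*-algebra `𝒪(Λ)` of an ordinal graph `Λ`: the universal C*-algebra generated by a
Cuntz-Krieger family for `Λ`. -/
abbrev CStar := G.presentation.Alg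

variable {G} in
theorem length_tail_lt {x y z : G.V} (f : y ⟶ z) (g : x ⟶ y)
    (h : ¬ (⟨g ≫ f⟩ : G.Path).IsGen) (hf : G.d f = ω ^ log ω (G.d (g ≫ f))) :
    G.d g < G.d (g ≫ f) := by
  have hc := G.d_comp g f
  refine lt_of_le_of_ne (hc ▸ le_add_self) fun heq => ?_
  have h0 : G.d (g ≫ f) ≠ 0 := fun h0 => h (Or.inl h0)
  rw [heq, hf] at hc
  have h1 := (add_le_right_iff_mul_omega0_le).1 hc.ge
  rw [← opow_succ] at h1
  exact (lt_opow_succ_log_self one_lt_omega0 _).not_ge h1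

variable {G} in
/-- The initial segment `e(ω^γ)` and the remainder `e(ω^γ)⁻¹e` of a path `e ≠ 0`, where `ω^γ` is
the leading power of `ω` in the Cantor normal form of `d(e)`. -/
theorem Path.exists_head (e : G.Path) (h : ¬ e.IsGen) :
    ∃ p : Σ y : G.V, (y ⟶ e.rng) × (e.src ⟶ y),
      G.d p.2.1 = ω ^ log ω e.length ∧ p.2.2 ≫ p.2.1 = e.hom :=
  (G.factorization e.hom _ (opow_log_le_self ω fun h0 => h (Or.inl h0))).exists

/-- The element `T_e` of `𝒪(Λ)` for an arbitrary path `e`. If the length of `e` is zero or a power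
of `ω` it is a generator, and otherwise it is the product of the generators given by the Cantor
normal form of `d(e)`: `T_e = T_f T_g` where `e = fg` and `d(f)` is the leading power of `ω`
in `d(e)`. -/
noncomputable def T (e : G.Path) : G.CStar :=
  open Classical in
  if h : e.IsGen then CStarPresentation.Alg.gen (P := G.presentation) ⟨e, h⟩
  else
    have hp := (e.exists_head h).choose_spec
    have : G.d (e.exists_head h).choose.2.2 < e.length := by
      have hlt := length_tail_lt (e.exists_head h).choose.2.1 (e.exists_head h).choose.2.2
      rw [hp.2] at hlt
      exact hlt h hp.1
    CStarPresentation.Alg.gen (P := G.presentation)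
        ⟨⟨(e.exists_head h).choose.2.1⟩, Or.inr ⟨_, hp.1⟩⟩ *
      T ⟨(e.exists_head h).choose.2.2⟩
termination_by e.length
decreasing_by exact this

/-- The sub-ordinal graph `Λ_α` of all paths of length less than `ω^α`. -/
def lower (α : Ordinal.{v}) : OrdinalGraph.{v, u₁, u₂} where
  V := G.V
  cat :=
    { Hom := fun x y => {f : x ⟶ y // G.d f < ω ^ α}
      id := fun x => ⟨𝟙 x, by rw [G.d_id]; exact opow_pos _ omega0_pos⟩
      comp := fun g f => ⟨g.1 ≫ f.1, by
        rw [G.d_comp]; exact isPrincipal_add_omega0_opow α f.2 g.2⟩ }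
  d f := G.d f.1
  d_id x := G.d_id x
  d_comp g f := G.d_comp g.1 f.1
  factorization := by
    rintro x z ⟨e, he⟩ γ hγ
    obtain ⟨⟨y, f, g⟩, ⟨hf, hfg⟩, huniq⟩ := G.factorization e γ hγ
    have hd : G.d e = G.d f + G.d g := by rw [← hfg, G.d_comp]
    have hfe : G.d f < ω ^ α := (hd ▸ le_self_add : G.d f ≤ G.d e).trans_lt he
    have hge : G.d g < ω ^ α := (hd ▸ le_add_self : G.d g ≤ G.d e).trans_lt he
    refine ⟨⟨y, ⟨f, hfe⟩, ⟨g, hge⟩⟩, ⟨hf, Subtype.ext hfg⟩, ?_⟩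
    rintro ⟨y', ⟨f', hf'⟩, ⟨g', hg'⟩⟩ ⟨h1, h2⟩
    have h := huniq ⟨y', f', g'⟩ ⟨h1, congrArg Subtype.val h2⟩
    cases h
    rfl

variable {G} in
/-- The inclusion of `Λ_α` into `Λ_β` for `α ≤ β`. -/
def incl {α β : Ordinal.{v}} (h : α ≤ β) (e : (G.lower α).Path) : (G.lower β).Path where
  src := (e.src : G.V)
  rng := (e.rng : G.V)
  hom := ⟨e.hom.1, e.hom.2.trans_le (opow_le_opow_right omega0_pos h)⟩

end OrdinalGraph

/-! ### Inductive limits of C*-algebras -/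

/-- A C*-algebra `L` with `*`-homomorphisms `ψ i : A i → L` is the C*-inductive limit of the system
`(A i, φ i j)`: the `ψ i` are compatible with the connecting maps, and every compatible family of
`*`-homomorphisms from the `A i` to a C*-algebra `B` factors uniquely through `L`. -/
def IsCStarInductiveLimit.{w, u₀, u₁, u₂} {I : Type u₀} [Preorder I] (A : I → Type u₁)
    [∀ i, NonUnitalCStarAlgebra (A i)] (φ : ∀ i j, i ≤ j → (A i →⋆ₙₐ[ℂ] A j))
    (L : Type u₂) [NonUnitalCStarAlgebra L] (ψ : ∀ i, A i →⋆ₙₐ[ℂ] L) : Prop :=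
  (∀ (i j : I) (h : i ≤ j), (ψ j).comp (φ i j h) = ψ i) ∧
  ∀ (B : Type w) [NonUnitalCStarAlgebra B] (ε : ∀ i, A i →⋆ₙₐ[ℂ] B),
    (∀ (i j : I) (h : i ≤ j), (ε j).comp (φ i j h) = ε i) →
    ∃! η : L →⋆ₙₐ[ℂ] B, ∀ i, η.comp (ψ i) = ε i

universe w v u₁ u₂

/-! Since `d` is additive, every factor of a path of length less than `ω ^ α` again has length less
than `ω ^ α`, so `Λ_α` sits inside `Λ_β` as a subcategory closed under factors. The point is that
the Cuntz-Krieger relations do not depend on the stage at which they are read. Two of them involve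
more than the paths they name. Orthogonality quantifies over all common extensions; but if `e` and
`f` have one, unique factorization makes the longer an extension of the shorter
(`mem_extensions_of_nonempty`), and this is visible in any `Λ_α` containing both. The sum relation
depends on regularity; but a `γ`-regular vertex of `Λ_α` has `γ < α` (`IsRegular.lt`), and then only
paths of length at most `ω ^ γ` matter, which are the same in `Λ_α` and `Λ_β`
(`isRegular_lower_iff`).

Hence the generators of `𝒪(Λ_β)` indexed by `Λ_α` form a Cuntz-Krieger family for `Λ_α`
(`CKRel.of_inclGen`), and the universal property yields the connecting maps. Functoriality holds
because homomorphisms are determined on generators; the formula for all `T_e` follows by peeling off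
leading powers of `ω`.

For a limit `β`, every relation of `Λ_β` already holds at some stage `α < β`
(`CKRel.exists_inclGen`). A compatible family `ε` therefore assigns to each generator a value
independent of the stage, these values satisfy all relations of `Λ_β`, and the universal property of
`𝒪(Λ_β)` gives the factorization. -/

namespace FreeStarAlg

/-! ### Universal property of the free `*`-algebra -/

variable {X A : Type*} [NonUnitalRing A] [StarRing A]

/-- The multiplicative extension to words of a map from the letters to a `*`-algebra. -/
def wordLift (f : X → A) : StarWord X →ₙ* A :=
  FreeSemigroup.lift (Sum.elim f fun x => star (f x))

theorem wordLift_star (f : X → A) (w : StarWord X) :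
    wordLift f (star w) = star (wordLift f w) := by
  induction w using FreeSemigroup.recOnMul with
  | ih1 x =>
    have h : star (FreeSemigroup.of x : StarWord X) = FreeSemigroup.of x.swap := rfl
    rw [h]
    rcases x with x | x <;> simp [wordLift]
  | ih2 x y hx hy => rw [star_mul, map_mul, map_mul, star_mul, hx, hy]

theorem hom_ext [Module ℂ A] {φ ψ : FreeStarAlg X →⋆ₙₐ[ℂ] A} (h : ∀ x, φ (of x) = ψ (of x))
    (a : FreeStarAlg X) : φ a = ψ a := by
  have hw (w : StarWord X) : φ (mono w 1) = ψ (mono w 1) := by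
    have hx (x : X ⊕ X) : φ (mono (FreeSemigroup.of x) 1) = ψ (mono (FreeSemigroup.of x) 1) := by
      rcases x with x | x
      · exact h x
      · rw [← star_of, map_star, map_star, h]
    induction w using FreeSemigroup.recOnMul with
    | ih1 x => exact hx x
    | ih2 x y _ hy => rw [← one_mul (1 : ℂ), ← mono_mul, map_mul, map_mul, hx, hy]
  induction a using FreeStarAlg.induction with
  | h0 => rw [map_zero, map_zero]
  | hm w c => rw [← mul_one c, ← smul_mono, map_smul, map_smul, hw]
  | ha a b ha hb => rw [map_add, map_add, ha, hb]

variable [Module ℂ A] [IsScalarTower ℂ A A] [SMulCommClass ℂ A A]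

/-- The linear extension of `wordLift`. -/
noncomputable def linearLift (f : X → A) : FreeStarAlg X →ₙₐ[ℂ] A :=
  (MonoidAlgebra.liftMagma ℂ (wordLift f) : MonoidAlgebra ℂ (StarWord X) →ₙₐ[ℂ] A)

theorem linearLift_mono (f : X → A) (w : StarWord X) (c : ℂ) :
    linearLift f (mono w c) = c • wordLift f w := by
  change (MonoidAlgebra.liftMagma ℂ (wordLift f)) (MonoidAlgebra.single w c) = _
  simp

/-- The universal property of the free `*`-algebra. -/
noncomputable def lift [StarModule ℂ A] (f : X → A) : FreeStarAlg X →⋆ₙₐ[ℂ] A where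
  __ := linearLift f
  map_star' a := by
    change linearLift f (star a) = star (linearLift f a)
    induction a using FreeStarAlg.induction with
    | h0 => simp
    | hm w c => rw [star_mono, linearLift_mono, linearLift_mono, wordLift_star, star_smul]
    | ha a b ha hb => rw [star_add, map_add, map_add, star_add, ha, hb]

@[simp]
theorem lift_of [StarModule ℂ A] (f : X → A) (x : X) : lift f (of x) = f x := by
  change linearLift f (mono _ 1) = _
  rw [linearLift_mono, one_smul]
  rfl

end FreeStarAlg

/-! ### Universal property of the C*-algebra of a presentation -/

/-- The C*-seminorm pulled back from a C*-algebra along a `*`-homomorphism. -/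
noncomputable def CStarSeminorm.comap {A B : Type*} [NonUnitalRing A] [StarRing A] [Module ℂ A]
    [NonUnitalCStarAlgebra B] (φ : A →⋆ₙₐ[ℂ] B) : CStarSeminorm A where
  toSeminorm := Seminorm.of (fun a => ‖φ a‖) (fun a b => by rw [map_add]; exact norm_add_le _ _)
    fun c a => by rw [map_smul, norm_smul]
  mul_le' a b := by
    change ‖φ (a * b)‖ ≤ ‖φ a‖ * ‖φ b‖
    rw [map_mul]
    exact norm_mul_le _ _
  star_mul_self' a := by
    change ‖φ (Star.star a * a)‖ = ‖φ a‖ ^ 2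
    rw [map_mul, map_star, CStarRing.norm_star_mul_self, sq]

namespace CStarPresentation.Alg

open UniformSpace

variable {P : CStarPresentation} {B : Type*} [NonUnitalCStarAlgebra B]

/-- Every admissible seminorm vanishes on `a - b`, hence so does their supremum, and the completion
is Hausdorff. -/
theorem coe_eq_coe_of_rel {a b : FreeStarAlg P.X} (h : P.rel a b) :
    (coe (P := P) a) = coe (P := P) b := by
  have h0 : ‖coe (P := P) (a - b : FreeStarAlg P.X)‖ = 0 := by
    refine (norm_coe (P := P) _).trans ?_
    change P.supFun (a - b) = 0
    exact le_antisymm (ciSup_le fun p => (p.2 a b h).le) (P.supFun_nonneg _)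
  have h1 : coe (P := P) (a - b : FreeStarAlg P.X) = coe (P := P) a - coe (P := P) b :=
    map_sub (coeHom (P := P)) a b
  rwa [h1, norm_eq_zero, sub_eq_zero] at h0

/-- The canonical map of the free `*`-algebra as a `*`-homomorphism. -/
noncomputable def coeStarHom : FreeStarAlg P.X →⋆ₙₐ[ℂ] P.Alg where
  toFun := coe (P := P)
  map_smul' := coe_smul (P := P)
  map_zero' := coe_zero (P := P)
  map_add' := coe_add (P := P)
  map_mul' := coe_mul (P := P)
  map_star' := coe_star (P := P)

/-- A `*`-homomorphism of C*-algebras is contractive, so it is determined by its restriction to the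
dense image of the free `*`-algebra. -/
theorem hom_ext {φ ψ : P.Alg →⋆ₙₐ[ℂ] B} (h : ∀ x, φ (gen x) = ψ (gen x)) : φ = ψ := by
  have hc (φ : P.Alg →⋆ₙₐ[ℂ] B) : Continuous φ :=
    AddMonoidHomClass.continuous_of_bound φ 1 fun a => by
      rw [one_mul]
      exact NonUnitalStarAlgHom.norm_apply_le φ a
  refine DFunLike.coe_injective (denseRange_coe.equalizer (hc φ) (hc ψ) ?_)
  exact funext fun a =>
    FreeStarAlg.hom_ext (φ := φ.comp coeStarHom) (ψ := ψ.comp coeStarHom) h a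

/-- The universal property of the C*-algebra of a presentation. -/
theorem exists_hom (f : P.X → B)
    (hf : ∀ a b, P.rel a b → FreeStarAlg.lift f a = FreeStarAlg.lift f b) :
    ∃ φ : P.Alg →⋆ₙₐ[ℂ] B, ∀ x, φ (gen x) = f x := by
  let F : P.Pre → B := fun a => FreeStarAlg.lift f a
  have hadd (a b : P.Pre) : F (a + b) = F a + F b := map_add (FreeStarAlg.lift f) a b
  -- The norm of `B` pulled back along the lift is an admissible C*-seminorm, so the greatest one
  -- dominates it; this makes the lift extend to the completion.
  have hle (a : P.Pre) : ‖F a‖ ≤ ‖a‖ :=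
    P.le_supFun ⟨CStarSeminorm.comap (FreeStarAlg.lift f), fun a b h => by
      change ‖FreeStarAlg.lift f (a - b)‖ = 0
      rw [map_sub, hf a b h, sub_self, norm_zero]⟩ a
  have hF : UniformContinuous F := by
    let F' : P.Pre →+ B := { toFun := F, map_zero' := map_zero (FreeStarAlg.lift f), map_add' := hadd }
    exact (AddMonoidHomClass.lipschitz_of_bound F' 1
      fun a => by rw [one_mul]; exact hle a).uniformContinuous
  let E : P.Alg → B := Completion.extension F
  have hE : Continuous E := Completion.continuous_extension
  have hEc (a : P.Pre) : E (coe a) = F a := Completion.extension_coe hF a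
  have h1 {g k : P.Alg → B} (hg : Continuous g) (hk : Continuous k)
      (h : ∀ a, g (coe a) = k (coe a)) (x : P.Alg) : g x = k x :=
    congr_fun (denseRange_coe.equalizer hg hk (funext h)) x
  have h2 {g k : P.Alg × P.Alg → B} (hg : Continuous g) (hk : Continuous k)
      (h : ∀ a b, g (coe a, coe b) = k (coe a, coe b)) (x y : P.Alg) : g (x, y) = k (x, y) :=
    congr_fun ((denseRange_coe.prodMap denseRange_coe).equalizer hg hk
      (funext fun p => h p.1 p.2)) (x, y)
  refine ⟨{ toFun := E, map_smul' := ?_, map_zero' := ?_, map_add' := ?_, map_mul' := ?_,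
            map_star' := ?_ }, fun x => ?_⟩
  · refine fun c => h1 (hE.comp (continuous_const_smul c)) (hE.const_smul c) fun a => ?_
    change E (c • coe a) = c • E (coe a)
    rw [← coe_smul, hEc, hEc]
    exact map_smul (FreeStarAlg.lift f) c a
  · change E 0 = 0
    rw [← coe_zero, hEc]
    exact map_zero (FreeStarAlg.lift f)
  · refine h2 (g := fun p => E (p.1 + p.2)) (k := fun p => E p.1 + E p.2) (by fun_prop)
      (by fun_prop) fun a b => ?_
    change E (coe a + coe b) = E (coe a) + E (coe b)
    rw [← coe_add, hEc, hEc, hEc, hadd]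
  · refine h2 (g := fun p => E (p.1 * p.2)) (k := fun p => E p.1 * E p.2) (by fun_prop)
      (by fun_prop) fun a b => ?_
    change E (coe a * coe b) = E (coe a) * E (coe b)
    rw [← coe_mul, hEc, hEc, hEc]
    exact map_mul (FreeStarAlg.lift f) a b
  · refine h1 (hE.comp continuous_star) (continuous_star.comp hE) fun a => ?_
    rw [← coe_star, hEc, hEc]
    exact map_star (FreeStarAlg.lift f) a
  · exact (hEc _).trans (FreeStarAlg.lift_of f x)

end CStarPresentation.Alg

namespace OrdinalGraph

open Ordinal CStarPresentation

/-! ### Cuntz-Krieger families and the elements `T_e` -/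

section CuntzKrieger

variable {G : OrdinalGraph.{v, u₁, u₂}}

/-- Both sides of a relation are `*`-polynomials in the family, so a relation for an image family
lifts along `φ`. Equalities known upstairs can then be pushed down. -/
theorem CKRel.of_hom {A B : Type*} [NonUnitalRing A] [StarRing A] [Module ℂ A] [NonUnitalRing B]
    [StarRing B] [Module ℂ B] (φ : A →⋆ₙₐ[ℂ] B) {S : G.Gen → A} {S' : G.Gen → B}
    (hS : ∀ e, φ (S e) = S' e) {a b : B} (h : G.CKRel S' a b) :
    ∃ a' b', G.CKRel S a' b' ∧ φ a' = a ∧ φ b' = b := by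
  cases h with
  | partialIsometry e => exact ⟨_, _, .partialIsometry e, by simp [hS, map_star], hS e⟩
  | star_mul_self e => exact ⟨_, _, .star_mul_self e, by simp [hS, map_star], hS _⟩
  | mul e f he hf hef hlt => exact ⟨_, _, .mul e f he hf hef hlt, by simp [hS], hS _⟩
  | orthogonal e f h => exact ⟨_, _, .orthogonal e f h, by simp [hS, map_star], map_zero φ⟩
  | sum v α h F hF => exact ⟨_, _, .sum v α h F hF, hS _, by simp [hS, map_star]⟩

theorem CKRel.map {A B : Type*} [NonUnitalRing A] [StarRing A] [Module ℂ A] [NonUnitalRing B]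
    [StarRing B] [Module ℂ B] (φ : A →⋆ₙₐ[ℂ] B) {S : G.Gen → A} {S' : G.Gen → B}
    (hS : ∀ e, φ (S e) = S' e) {a b : A} (h : G.CKRel S a b) : G.CKRel S' (φ a) (φ b) := by
  obtain rfl : (fun e => φ (S e)) = S' := funext hS
  cases h with
  | partialIsometry e => simpa [map_star] using CKRel.partialIsometry (S := fun e => φ (S e)) e
  | star_mul_self e => simpa [map_star] using CKRel.star_mul_self (S := fun e => φ (S e)) e
  | mul e f he hf hef hlt => simpa [map_star] using CKRel.mul (S := fun e => φ (S e)) e f he hf hef hlt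
  | orthogonal e f h => simpa [map_star] using CKRel.orthogonal (S := fun e => φ (S e)) e f h
  | sum v α h F hF => simpa [map_star] using CKRel.sum (S := fun e => φ (S e)) v α h F hF

/-- The generators of `𝒪(Λ)` form a Cuntz-Krieger family. -/
theorem eq_of_ckRel_gen {a b : G.CStar} (h : G.CKRel (Alg.gen (P := G.presentation)) a b) :
    a = b := by
  obtain ⟨a', b', h', rfl, rfl⟩ :=
    CKRel.of_hom (Alg.coeStarHom (P := G.presentation)) (fun _ => rfl) h
  exact Alg.coe_eq_coe_of_rel (P := G.presentation) h'

/-- The universal property of `𝒪(Λ)`. -/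
theorem exists_hom_of_ckRel {B : Type*} [NonUnitalCStarAlgebra B] (S : G.Gen → B)
    (hS : ∀ a b, G.CKRel S a b → a = b) :
    ∃ φ : G.CStar →⋆ₙₐ[ℂ] B, ∀ e, φ (Alg.gen (P := G.presentation) e) = S e :=
  Alg.exists_hom (P := G.presentation) S fun _ _ h =>
    hS _ _ (CKRel.map (FreeStarAlg.lift S) (FreeStarAlg.lift_of S) h)

theorem T_of_isGen (e : G.Path) (h : e.IsGen) :
    G.T e = Alg.gen (P := G.presentation) ⟨e, h⟩ := by
  rw [T, dif_pos h]

/-- Frees the recursion for `T` from its choice of a factorization: by uniqueness the chosen one is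
the given one. -/
theorem T_comp {x y z : G.V} (f : y ⟶ z) (g : x ⟶ y) (h : ¬ (⟨g ≫ f⟩ : G.Path).IsGen)
    (hf : G.d f = ω ^ log ω (G.d (g ≫ f))) :
    G.T ⟨g ≫ f⟩ = Alg.gen (P := G.presentation) ⟨⟨f⟩, Or.inr ⟨_, hf⟩⟩ * G.T ⟨g⟩ := by
  rw [T, dif_neg h]
  have hp := ((⟨g ≫ f⟩ : G.Path).exists_head h).choose_spec
  obtain ⟨p, -, huniq⟩ := G.factorization (g ≫ f) _ (opow_log_le_self ω fun h0 => h (Or.inl h0))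
  have h1 : (⟨y, f, g⟩ : Σ y : G.V, (y ⟶ z) × (x ⟶ y)) =
      ((⟨g ≫ f⟩ : G.Path).exists_head h).choose :=
    (huniq _ ⟨hf, rfl⟩).trans (huniq _ hp).symm
  -- The factorization is generalized to a variable because the types of its morphisms and the proof
  -- carried by the generator depend on it; the equality can then be substituted.
  have key (q : Σ y : G.V, (y ⟶ z) × (x ⟶ y)) (hq : G.d q.2.1 = ω ^ log ω (G.d (g ≫ f)))
      (h : ⟨y, f, g⟩ = q) : Alg.gen (P := G.presentation) ⟨⟨q.2.1⟩, Or.inr ⟨_, hq⟩⟩ *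
        G.T ⟨q.2.2⟩ = Alg.gen (P := G.presentation) ⟨⟨f⟩, Or.inr ⟨_, hf⟩⟩ * G.T ⟨g⟩ := by
    subst h
    rfl
  exact key _ hp.1 h1

end CuntzKrieger

/-! ### Comparing extensions and regularity in `Λ_α` and `Λ_β` -/

variable {G : OrdinalGraph.{v, u₁, u₂}} {α β γ : Ordinal.{v}}

/-- A path of `Λ_β` of length less than `ω^α`, as a path of `Λ_α`. -/
def restrict (α : Ordinal.{v}) (e : (G.lower β).Path) (he : e.length < ω ^ α) :
    (G.lower α).Path where
  src := (e.src : G.V)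
  rng := (e.rng : G.V)
  hom := ⟨e.hom.1, he⟩

theorem incl_injective (h : α ≤ β) : Function.Injective (incl (G := G) h) := by
  rintro ⟨⟨e, he⟩⟩ ⟨⟨f, hf⟩⟩ hef
  simp only [incl] at hef
  cases hef
  rfl

/-- The inclusion of the generators of `Λ_α` into those of `Λ_β`. -/
def inclGen (h : α ≤ β) (e : (G.lower α).Gen) : (G.lower β).Gen := ⟨incl h e.1, e.2⟩

theorem inclGen_injective (h : α ≤ β) : Function.Injective (inclGen (G := G) h) :=
  fun _ _ hef => Subtype.ext (incl_injective h (congrArg Subtype.val hef))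

theorem exists_inclGen_eq (h : α ≤ β) (e : (G.lower β).Gen) (he : e.1.length < ω ^ α) :
    ∃ e' : (G.lower α).Gen, inclGen h e' = e :=
  ⟨⟨restrict α e.1 he, e.2⟩, rfl⟩

theorem rng_eq_of_mem_extensions {e p : G.Path} (h : p ∈ e.extensions) : p.rng = e.rng := by
  obtain ⟨w, g, rfl⟩ := h
  rfl

theorem mk_mem_extensions {w x z : G.V} {e : x ⟶ z} {p : w ⟶ z} :
    (⟨p⟩ : G.Path) ∈ (⟨e⟩ : G.Path).extensions ↔ ∃ g : w ⟶ x, p = g ≫ e := by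
  constructor
  · rintro ⟨w', g, h⟩
    rw [Path.mk.injEq] at h
    obtain ⟨rfl, -, h⟩ := h
    exact ⟨g, eq_of_heq h⟩
  · rintro ⟨g, rfl⟩
    exact ⟨w, g, rfl⟩

theorem mem_extensions_self (e : G.Path) : e ∈ e.extensions :=
  ⟨e.src, 𝟙 _, by rw [Category.id_comp]⟩

/-- Cut `f` at length `d(e)`. A common extension then has two factorizations with first factor of
length `d(e)`, one starting with `e` and one with the initial segment of `f`; by uniqueness these
coincide. -/
theorem mem_extensions_of_nonempty {e f : G.Path} (h : (e.extensions ∩ f.extensions).Nonempty)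
    (hle : e.length ≤ f.length) : f ∈ e.extensions := by
  obtain ⟨p, h1, h2⟩ := h
  have hr := (rng_eq_of_mem_extensions h1).symm.trans (rng_eq_of_mem_extensions h2)
  obtain @⟨x, z, e⟩ := e
  obtain @⟨y, _, f⟩ := f
  obtain rfl : z = _ := hr
  obtain ⟨w, g, rfl⟩ := h1
  obtain ⟨k, hk⟩ := mk_mem_extensions.1 h2
  obtain ⟨⟨t, e', p⟩, ⟨h1, hp⟩, -⟩ := G.factorization f _ hle
  change p ≫ e' = f at hp
  subst hp
  obtain ⟨q, -, huniq⟩ := G.factorization (g ≫ e) (G.d e) (by rw [G.d_comp]; exact le_self_add)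
  have h3 := (huniq ⟨x, e, g⟩ ⟨rfl, rfl⟩).trans
    (huniq ⟨t, e', k ≫ p⟩ ⟨h1, by simp [hk]⟩).symm
  cases h3
  exact mk_mem_extensions.2 ⟨p, rfl⟩

/-- If `f = eg` then `d(g) ≤ d(e) + d(g) = d(f)`, so a cofactor found in `Λ_β` already lies in
`Λ_α`. -/
theorem incl_mem_extensions_iff (h : α ≤ β) {e f : (G.lower α).Path} :
    incl h f ∈ (incl h e).extensions ↔ f ∈ e.extensions := by
  constructor
  · intro hm
    have hr := rng_eq_of_mem_extensions hm
    obtain @⟨x, z, e, he⟩ := e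
    obtain @⟨y, _, f, hf⟩ := f
    obtain rfl : _ = z := hr
    obtain ⟨g, hg⟩ := mk_mem_extensions.1 hm
    have hg' : f = g.1 ≫ e := congrArg Subtype.val hg
    have hd : G.d g.1 ≤ G.d f := (le_add_self : _ ≤ G.d e + G.d g.1).trans_eq
      ((G.d_comp g.1 e).symm.trans (congrArg G.d hg'.symm))
    exact mk_mem_extensions.2 ⟨⟨g.1, hd.trans_lt hf⟩, Subtype.ext hg'⟩
  · rintro ⟨w, g, rfl⟩
    exact ⟨w, ⟨g.1, g.2.trans_le (opow_le_opow_right omega0_pos h)⟩, rfl⟩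

theorem extensions_inter_incl_eq_empty (h : α ≤ β) (e f : (G.lower α).Path) :
    (incl h e).extensions ∩ (incl h f).extensions = ∅ ↔ e.extensions ∩ f.extensions = ∅ := by
  simp only [← Set.not_nonempty_iff_eq_empty, not_iff_not]
  constructor
  · intro hne
    rcases le_total e.length f.length with hle | hle
    · exact ⟨f, (incl_mem_extensions_iff h).1 (mem_extensions_of_nonempty hne hle), mem_extensions_self f⟩
    · rw [Set.inter_comm] at hne
      exact ⟨e, mem_extensions_self e, (incl_mem_extensions_iff h).1 (mem_extensions_of_nonempty hne hle)⟩
  · rintro ⟨p, h1, h2⟩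
    exact ⟨_, (incl_mem_extensions_iff h).2 h1, (incl_mem_extensions_iff h).2 h2⟩

/-- Source-regularity tested on the vertex `v` itself produces a path of length `ω ^ γ` in `Λ_α`. -/
theorem IsRegular.lt {v : G.V} (h : (G.lower α).IsRegular γ v) : γ < α := by
  obtain ⟨f, -, hf⟩ := h.1 ((G.lower α).vertex v).1 rfl
    (((G.lower α).d_id v).trans_lt (opow_pos _ omega0_pos))
  exact (opow_lt_opow_iff_right one_lt_omega0).1 (hf ▸ f.hom.2)

/-- Regularity only mentions paths of length at most `ω ^ γ < ω ^ α`, which both graphs share. -/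
theorem isRegular_lower_iff (h : α ≤ β) (hγ : γ < α) (v : G.V) :
    (G.lower α).IsRegular γ v ↔ (G.lower β).IsRegular γ v := by
  have hlt : ω ^ γ < ω ^ α := (opow_lt_opow_iff_right one_lt_omega0).2 hγ
  refine and_congr ⟨fun H e he hl => ?_, fun H e he hl => ?_⟩ ?_
  · obtain ⟨f, hf, hf'⟩ := H (restrict α e (hl.trans hlt)) he hl
    exact ⟨incl h f, hf, hf'⟩
  · obtain ⟨f, hf, hf'⟩ := H (incl h e) he hl
    exact ⟨restrict α f (hf'.trans_lt hlt), hf, hf'⟩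
  · refine (Set.finite_image_iff (incl_injective h).injOn).symm.trans
      (iff_of_eq (congrArg Set.Finite (Set.ext fun f => ⟨?_, fun hf => ?_⟩)))
    · rintro ⟨f, hf, rfl⟩
      exact hf
    · exact ⟨restrict α f (hf.2.trans_lt hlt), hf, rfl⟩

/-! ### Moving Cuntz-Krieger relations between stages -/

theorem CKRel.of_inclGen {A : Type*} [NonUnitalRing A] [StarRing A] (h : α ≤ β)
    {S : (G.lower β).Gen → A} {a b : A}
    (hab : (G.lower α).CKRel (fun e => S (inclGen h e)) a b) : (G.lower β).CKRel S a b := by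
  cases hab with
  | partialIsometry e => exact .partialIsometry (inclGen h e)
  | star_mul_self e => exact .star_mul_self (inclGen h e)
  | mul e f he hf hef hlt =>
    exact CKRel.mul (G := G.lower β) (S := S)
      (incl h ⟨e⟩).hom (incl h ⟨f⟩).hom he hf hef hlt
  | orthogonal e f hd =>
    exact .orthogonal (inclGen h e) (inclGen h f) ((extensions_inter_incl_eq_empty h _ _).2 hd)
  | sum v γ hv F hF =>
    have hγ : γ < α := IsRegular.lt hv
    -- As `γ < α`, passing to `Λ_β` adds no path of length `ω ^ γ` with range `v`, so the image of
    -- `F` still indexes the whole sum.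
    have := CKRel.sum (S := S) v γ ((isRegular_lower_iff (G := G) h hγ v).1 hv)
      (F.map ⟨_, inclGen_injective h⟩) fun e => by
        rw [Finset.mem_map]
        constructor
        · rintro ⟨e, he, rfl⟩
          exact (hF e).1 he
        · rintro ⟨h1, h2⟩
          obtain ⟨e, rfl⟩ := exists_inclGen_eq h e
            (h2.trans_lt ((opow_lt_opow_iff_right one_lt_omega0).2 hγ))
          exact ⟨e, (hF e).2 ⟨h1, h2⟩, rfl⟩
    rw [Finset.sum_map] at this
    exact this

/-- For a limit `β`, `ω ^ β` is the supremum of the `ω ^ α` with `α < β`, so each path lies at an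
earlier stage. A relation needs only one stage, since the lengths it involves are bounded by a
single such `ω ^ α`. -/
theorem CKRel.exists_inclGen {A : Type*} [NonUnitalRing A] [StarRing A]
    (hβ : Order.IsSuccLimit β) {S : (G.lower β).Gen → A} {a b : A} (hab : (G.lower β).CKRel S a b) :
    ∃ α, ∃ h : α < β, (G.lower α).CKRel (fun e => S (inclGen h.le e)) a b := by
  have key (e : (G.lower β).Gen) : ∃ α, ∃ _ : α < β, e.1.length < ω ^ α := by
    obtain ⟨α, h, he⟩ := (lt_opow_of_isSuccLimit omega0_ne_zero hβ).1 e.1.hom.2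
    exact ⟨α, h, he⟩
  cases hab with
  | partialIsometry e =>
    obtain ⟨α, h, he⟩ := key e
    obtain ⟨e, rfl⟩ := exists_inclGen_eq h.le e he
    exact ⟨α, h, .partialIsometry e⟩
  | star_mul_self e =>
    obtain ⟨α, h, he⟩ := key e
    obtain ⟨e, rfl⟩ := exists_inclGen_eq h.le e he
    exact ⟨α, h, .star_mul_self e⟩
  | mul e f he hf hef hlt =>
    -- A stage for `f` also contains `e`, because `d(e) < d(f)`, and then their composite.
    obtain ⟨α, h, h1⟩ := key ⟨⟨f⟩, hf⟩
    refine ⟨α, h, ?_⟩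
    exact CKRel.mul (G := G.lower α) (S := fun e => S (inclGen h.le e)) ⟨e.1, hlt.trans h1⟩ ⟨f.1, h1⟩
      he hf hef hlt
  | orthogonal e f hd =>
    obtain ⟨α₁, h₁, he⟩ := key e
    obtain ⟨α₂, h₂, hf⟩ := key f
    have h : max α₁ α₂ < β := max_lt h₁ h₂
    obtain ⟨e, rfl⟩ := exists_inclGen_eq h.le e
      (he.trans_le (opow_le_opow_right omega0_pos (le_max_left _ _)))
    obtain ⟨f, rfl⟩ := exists_inclGen_eq h.le f
      (hf.trans_le (opow_le_opow_right omega0_pos (le_max_right _ _)))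
    exact ⟨_, h, .orthogonal e f ((extensions_inter_incl_eq_empty h.le _ _).1 hd)⟩
  | sum v γ hv F hF =>
    have hγ : γ < β := IsRegular.lt hv
    -- Paths of length exactly `ω ^ γ` are missing from `Λ_γ` but present at the next stage, which
    -- is still below the limit.
    have h : Order.succ γ < β := hβ.succ_lt hγ
    refine ⟨_, h, ?_⟩
    have := CKRel.sum (S := fun e => S (inclGen h.le e)) v γ
      ((isRegular_lower_iff (G := G) h.le (Order.lt_succ γ) v).2 hv)
      (F.preimage (inclGen h.le) (inclGen_injective h.le).injOn) fun e => by
        rw [Finset.mem_preimage]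
        exact hF _
    rw [Finset.sum_preimage (inclGen h.le) F (inclGen_injective h.le).injOn
      (fun e => S e * star (S e))] at this
    · exact this
    · intro e he hne
      obtain ⟨e', rfl⟩ := exists_inclGen_eq h.le e (((hF e).1 he).2.trans_lt
        ((opow_lt_opow_iff_right one_lt_omega0).2 (Order.lt_succ γ)))
      exact (hne ⟨_, rfl⟩).elim

/-! ### Connecting maps and the inductive limit -/

/-- The connecting maps `𝒪(Λ_α) → 𝒪(Λ_β)`. -/
theorem exists_connecting (G : OrdinalGraph.{v, u₁, u₂}) (h : α ≤ β) :
    ∃ φ : (G.lower α).CStar →⋆ₙₐ[ℂ] (G.lower β).CStar, ∀ e : (G.lower α).Gen,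
      φ (Alg.gen (P := (G.lower α).presentation) e) =
        Alg.gen (P := (G.lower β).presentation) (inclGen h e) :=
  exists_hom_of_ckRel _ fun _ _ hab => eq_of_ckRel_gen (CKRel.of_inclGen h hab)

/-- Induction on length: inclusion preserves `d`, so it carries the head and tail of the Cantor
normal form factorization to those of the image, and the tail is strictly shorter. -/
theorem map_T (h : α ≤ β) {φ : (G.lower α).CStar →⋆ₙₐ[ℂ] (G.lower β).CStar}
    (hφ : ∀ e : (G.lower α).Gen, φ (Alg.gen (P := (G.lower α).presentation) e) =
      Alg.gen (P := (G.lower β).presentation) (inclGen h e)) (e : (G.lower α).Path) :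
    φ ((G.lower α).T e) = (G.lower β).T (incl h e) := by
  induction hl : e.length using WellFoundedLT.induction generalizing e with
  | ind l ih =>
  by_cases hg : e.IsGen
  · rw [T_of_isGen e hg, hφ]
    exact (T_of_isGen (incl h e) hg).symm
  · obtain @⟨x, z, e⟩ := e
    obtain ⟨⟨y, f, g⟩, hf, rfl⟩ : ∃ p : Σ y, (y ⟶ z) × (x ⟶ y),
      (G.lower α).d p.2.1 = ω ^ log ω ((G.lower α).d e) ∧ p.2.2 ≫ p.2.1 = e :=
        Path.exists_head _ hg
    have hlt := length_tail_lt f g hg hf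
    rw [T_comp f g hg hf, map_mul, hφ, ih _ (hl ▸ hlt) ⟨g⟩ rfl]
    exact (T_comp (G := G.lower β) (incl h ⟨f⟩).hom (incl h ⟨g⟩).hom hg hf).symm

theorem isCStarInductiveLimit_lower (hβ : Order.IsSuccLimit β)
    (ρ : ∀ α β : Ordinal.{v}, α ≤ β → ((G.lower α).CStar →⋆ₙₐ[ℂ] (G.lower β).CStar))
    (hρ : ∀ (α β : Ordinal.{v}) (h : α ≤ β) (e : (G.lower α).Gen),
      ρ α β h (Alg.gen (P := (G.lower α).presentation) e) =
        Alg.gen (P := (G.lower β).presentation) (inclGen h e)) :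
    IsCStarInductiveLimit.{w} (I := Set.Iio β) (fun α => (G.lower α.1).CStar)
      (fun α γ h => ρ α.1 γ.1 h) (G.lower β).CStar (fun α => ρ α.1 β (le_of_lt α.2)) := by
  refine ⟨fun α γ h => Alg.hom_ext (P := (G.lower α.1).presentation) fun e => ?_,
    fun B _ ε hε => ?_⟩
  · rw [NonUnitalStarAlgHom.comp_apply, hρ, hρ, hρ]
    rfl
  · have key (e : (G.lower β).Gen) : ∃ α : Set.Iio β, e.1.length < ω ^ α.1 := by
      obtain ⟨α, h, he⟩ := (lt_opow_of_isSuccLimit omega0_ne_zero hβ).1 e.1.hom.2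
      exact ⟨⟨α, h⟩, he⟩
    -- Each generator of `Λ_β` gets an arbitrary stage `δ e` and its preimage `lo e` there.
    choose δ hδ using key
    choose lo hlo using fun e => exists_inclGen_eq (le_of_lt (δ e).2) e (hδ e)
    let S : (G.lower β).Gen → B := fun e =>
      ε (δ e) (Alg.gen (P := (G.lower (δ e).1).presentation) (lo e))
    -- The value of `S` does not depend on the chosen stage: two stages are compared at their
    -- maximum, where the two preimages agree by injectivity of the inclusion.
    have hS (α : Set.Iio β) (e : (G.lower α.1).Gen) :
        ε α (Alg.gen (P := (G.lower α.1).presentation) e) = S (inclGen (le_of_lt α.2) e) := by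
      set e' := inclGen (le_of_lt α.2) e with he'
      have h1 := hε α (max α (δ e')) (le_max_left _ _)
      have h2 := hε (δ e') (max α (δ e')) (le_max_right _ _)
      change _ = ε (δ e') _
      rw [← h1, ← h2, NonUnitalStarAlgHom.comp_apply, NonUnitalStarAlgHom.comp_apply, hρ, hρ]
      congr 2
      apply inclGen_injective (le_of_lt (max α (δ e')).2)
      exact he'.symm.trans (hlo e').symm
    -- A relation for `S` descends to one stage, where it is the `ε`-image of a relation that holds
    -- in `𝒪(Λ_α)`.
    obtain ⟨η, hη⟩ := exists_hom_of_ckRel S fun a b hab => by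
      obtain ⟨α, h, hab⟩ := hab.exists_inclGen hβ
      obtain ⟨a', b', hab', rfl, rfl⟩ := CKRel.of_hom (ε ⟨α, h⟩) (hS ⟨α, h⟩) hab
      rw [eq_of_ckRel_gen hab']
    refine ⟨η, fun α => Alg.hom_ext (P := (G.lower α.1).presentation) fun e => ?_,
      fun η' hη' => Alg.hom_ext (P := (G.lower β).presentation) fun e => ?_⟩
    · rw [NonUnitalStarAlgHom.comp_apply, hρ, hη, hS]
    · rw [hη]
      change _ = ε (δ e) _
      rw [← hη', NonUnitalStarAlgHom.comp_apply, hρ, hlo]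

end OrdinalGraph

theorem mainTheorem4 (G : OrdinalGraph.{v, u₁, u₂}) :
    ∃ ρ : ∀ α β : Ordinal.{v}, α ≤ β → ((G.lower α).CStar →⋆ₙₐ[ℂ] (G.lower β).CStar),
      (∀ (α β : Ordinal.{v}) (h : α ≤ β) (e : (G.lower α).Path),
        ρ α β h ((G.lower α).T e) = (G.lower β).T (OrdinalGraph.incl h e)) ∧
      (∀ α : Ordinal.{v}, ρ α α le_rfl = NonUnitalStarAlgHom.id ℂ (G.lower α).CStar) ∧
      (∀ (α β γ : Ordinal.{v}) (h₁ : α ≤ β) (h₂ : β ≤ γ),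
        (ρ β γ h₂).comp (ρ α β h₁) = ρ α γ (h₁.trans h₂)) ∧
      ∀ β : Ordinal.{v}, Order.IsSuccLimit β →
        IsCStarInductiveLimit.{w} (I := Set.Iio β) (fun α => (G.lower α.1).CStar)
          (fun α γ h => ρ α.1 γ.1 h) (G.lower β).CStar (fun α => ρ α.1 β (le_of_lt α.2)) := by
  choose ρ hρ using fun (α β : Ordinal.{v}) (h : α ≤ β) => G.exists_connecting h
  refine ⟨ρ, fun α β h e => OrdinalGraph.map_T h (hρ α β h) e, fun α => ?_,
    fun α β γ h₁ h₂ => ?_,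
    fun β hβ => OrdinalGraph.isCStarInductiveLimit_lower hβ ρ hρ⟩
  · refine CStarPresentation.Alg.hom_ext (P := (G.lower α).presentation) fun e => ?_
    rw [hρ]
    rfl
  · refine CStarPresentation.Alg.hom_ext (P := (G.lower α).presentation) fun e => ?_
    rw [NonUnitalStarAlgHom.comp_apply, hρ, hρ, hρ]
    rfl
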